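/- The game of Cops and Robbers on a digraph $G$ with $k$ cops is played as follows. First the $k$ cops are placed on vertices of $G$ (several cops may share a vertex), then the robber chooses a starting vertex. The players alternate turns, starting with the cops; on a turn, each agent of the player in question either stays where it is or moves along one edge of $G$ in the direction of that edge. Both players see all positions. The cops win if at some time the robber is on the same vertex as a cop. The cop number of $G$ is the least $k$ for which the cops have a strategy that guarantees a win in finite time. **Theorem.** There is a finite, strongly connected planar digraph on which three cops have no winning strategy; that is, its cop number is at least $4$. (A digraph is planar if its underlying undirected graph can be drawn in the plane without crossings.) -/

import Mathlib

namespace CopsRobbers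

/-- A nonempty digraph in which every vertex can be reached from every other one along the
directions of the edges. -/
def StronglyConnected {V : Type*} (G : Digraph V) : Prop :=
  Nonempty V ∧ ∀ u v : V, Relation.ReflTransGen G.Adj u v

/-- A drawing of a simple graph in the Euclidean plane: distinct vertices are distinct points, each
edge is a simple arc between its ends, an arc passes through no vertex other than its two ends, and
two distinct arcs meet at most in common ends. (Values of `arc` off the edge set are irrelevant.) -/
structure PlaneDrawing {V : Type*} (H : SimpleGraph V) where
  point : V → EuclideanSpace ℝ (Fin 2)
  point_injective : Function.Injective point
  arc : Sym2 V → Set (EuclideanSpace ℝ (Fin 2))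
  isArc : ∀ u v : V, H.Adj u v →
    ∃ γ : Path (point u) (point v), Function.Injective γ ∧ Set.range γ = arc s(u, v)
  arc_avoids : ∀ e ∈ H.edgeSet, ∀ w : V, point w ∈ arc e → w ∈ e
  arcs_meet : ∀ e ∈ H.edgeSet, ∀ f ∈ H.edgeSet, e ≠ f →
    ∀ x ∈ arc e, x ∈ arc f → ∃ w : V, w ∈ e ∧ w ∈ f ∧ x = point w

/-- A digraph is planar if its underlying undirected graph can be drawn in the plane. -/
def Planar {V : Type*} (G : Digraph V) : Prop :=
  Nonempty (PlaneDrawing G.toSimpleGraphInclusive)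

/-- One turn of a single agent: stay, or move along one edge in its direction. -/
def Step {V : Type*} (G : Digraph V) (u v : V) : Prop :=
  v = u ∨ G.Adj u v

/-- A strategy for `k` cops: the initial placement, and a legal move for each situation, which may
depend on the list of all earlier positions (latest first), on the current positions `c` of the
cops, and on the current position `r` of the robber. -/
structure CopStrategy {V : Type*} (G : Digraph V) (k : ℕ) where
  start : Fin k → V
  move : List ((Fin k → V) × V) → (Fin k → V) → V → (Fin k → V)
  move_legal : ∀ h c r i, Step G (c i) (move h c r i)

/-- The earlier positions and the current cops' positions after `n` rounds, when the cops follow the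
strategy `σ` and the robber visits `r 0, r 1, …`. -/
def CopStrategy.play {V : Type*} {G : Digraph V} {k : ℕ} (σ : CopStrategy G k) (r : ℕ → V) :
    ℕ → List ((Fin k → V) × V) × (Fin k → V)
  | 0 => ([], σ.start)
  | n + 1 =>
    (((σ.play r n).2, r n) :: (σ.play r n).1, σ.move (σ.play r n).1 (σ.play r n).2 (r n))

/-- The positions of the cops after `n` moves. -/
def CopStrategy.cops {V : Type*} {G : Digraph V} {k : ℕ} (σ : CopStrategy G k) (r : ℕ → V) (n : ℕ) :
    Fin k → V :=
  (σ.play r n).2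

/-- `k` cops can win: some strategy of theirs catches every robber in finite time. After the cops'
placement the robber picks `r 0`; in round `n` the cops move first, while the robber is at `r n`,
and then the robber moves to `r (n + 1)`. The robber is caught once it is on the same vertex as a
cop, be it after its own turn or after the cops' turn. -/
def CopsWin {V : Type*} (G : Digraph V) (k : ℕ) : Prop :=
  ∃ σ : CopStrategy G k, ∀ r : ℕ → V, (∀ n, Step G (r n) (r (n + 1))) →
    ∃ n, ∃ i : Fin k, σ.cops r n i = r n ∨ σ.cops r (n + 1) i = r n

/-- The least number of cops that can win (`⊤` if there is none, which cannot happen on a finite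
digraph). -/
noncomputable def copNumber {V : Type*} (G : Digraph V) : ℕ∞ :=
  ⨅ (k : ℕ) (_ : CopsWin G k), (k : ℕ∞)

end CopsRobbers

namespace CopsRobbers

/-! The digraph is a Cayley digraph of the alternating group on five letters, with the triangle
edges subdivided. Left multiplications are automorphisms, so a robber at a group element may be
taken to be at `0`. It can then stay, go along the pentagon to `1`, or commit itself to two moves
through the midpoint `60` to `2`.

The evasion rests on a potential. Each cop has a `weight` relative to the robber, and a total below
12 counts as safe. Vertices from which `0` is occupied or reachable in one move weigh 12, so a safe
robber cannot be caught at once. A finite check (`exists_copMoves`, `copMoves_insufficient`) shows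
that after any cop move from a safe situation one of the three options has total below 12, so safety
persists forever. A safe start exists by averaging over five places (`exists_safeAt`).

Planarity is certified by integer coordinates of a straight-line drawing and orientation tests on
pairs of edges. -/

/-! ### Evasion by an invariant -/

/-- If the robber can keep up an invariant `Inv` between its own position and that of the cops
(at the times when the cops are to move) without being caught, then the cops cannot win. -/
theorem not_copsWin_of_invariant {V : Type*} {G : Digraph V} {k : ℕ}
    (Inv : V → (Fin k → V) → Prop) (exists_start : ∀ c, ∃ r, Inv r c)
    (evade : ∀ r c c', Inv r c → (∀ i, Step G (c i) (c' i)) →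
      (∀ i, c i ≠ r ∧ c' i ≠ r) ∧ ∃ r', Step G r r' ∧ Inv r' c') :
    ¬ CopsWin G k := by
  rintro ⟨σ, hσ⟩
  obtain ⟨r₀, hr₀⟩ := exists_start σ.start
  choose next hnext using fun r c c' h h' => (evade r c c' h h').2
  -- The robber's walk has to be one fixed sequence, although its choices depend on the cops. Both
  -- sides are therefore run together by recursion, and `hplay` identifies the result with the play
  -- of `σ` against that walk.
  let State := {s : (List ((Fin k → V) × V) × (Fin k → V)) × V // Inv s.2 s.1.2}
  let succ : State → State := fun s =>
    ⟨(((s.1.1.2, s.1.2) :: s.1.1.1, σ.move s.1.1.1 s.1.1.2 s.1.2),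
      next _ _ _ s.2 (σ.move_legal s.1.1.1 s.1.1.2 s.1.2)),
      (hnext _ _ _ s.2 (σ.move_legal s.1.1.1 s.1.1.2 s.1.2)).2⟩
  let state : ℕ → State := fun n => n.rec ⟨(([], σ.start), r₀), hr₀⟩ fun _ s => succ s
  have hplay : ∀ n, σ.play (fun m => (state m).1.2) n = (state n).1.1 := by
    intro n
    induction n with
    | zero => rfl
    | succ n ih => rw [CopStrategy.play, ih]
  obtain ⟨n, i, hn⟩ := hσ (fun m => (state m).1.2) fun n =>
    (hnext _ _ _ (state n).2 (σ.move_legal _ _ _)).1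
  have hcaught := (evade _ _ _ (state n).2
    (σ.move_legal (state n).1.1.1 (state n).1.1.2 (state n).1.2)).1 i
  rw [CopStrategy.cops, CopStrategy.cops, hplay, hplay] at hn
  exact hn.elim hcaught.1 hcaught.2

/-- Lets kernel evaluation run only through the short list `l a`, such as the possible moves from a
vertex. -/
theorem forall_mem_of_all {α β : Type*} {l : α → List β} {p : α → β → Prop}
    [∀ a b, Decidable (p a b)] (h : ∀ a, ((l a).all fun b => decide (p a b)) = true) :
    ∀ a, ∀ b ∈ l a, p a b := fun a b hb =>
  of_decide_eq_true (List.all_eq_true.1 (h a) b hb)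

/-! ### The digraph and its symmetries -/

/-- Moving along the first generator, of order five, of the alternating group on five letters. -/
def pentagonTable : List ℕ :=
  [1, 3, 5, 7, 9, 11, 13, 14, 16, 18, 2, 20, 22, 24, 0, 26, 28, 4, 30, 21, 10, 32, 34, 6, 36,
   15, 38, 8, 40, 31, 17, 42, 44, 12, 46, 37, 23, 48, 49, 41, 27, 50, 52, 19, 43, 47, 33, 54,
   56, 25, 58, 29, 51, 45, 59, 35, 55, 39, 57, 53]

/-- Moving along the second generator, of order three. -/
def triangleTable : List ℕ :=
  [2, 4, 6, 8, 10, 12, 0, 15, 17, 19, 1, 21, 23, 25, 13, 27, 29, 3, 31, 20, 9, 33, 35, 5, 37,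
   14, 39, 7, 41, 30, 16, 43, 45, 11, 47, 36, 22, 49, 48, 40, 26, 51, 53, 18, 42, 46, 32, 55,
   57, 24, 59, 28, 50, 44, 58, 34, 54, 38, 56, 52]

/-- The out-neighbours of a vertex: `u < 60` stands for an element of the group, and `u + 60` for
the midpoint of the edge that leaves `u` in the direction of the second generator. -/
def outs (u : Fin 120) : List (Fin 120) :=
  if u.val < 60 then [Fin.ofNat 120 (pentagonTable.getD u 0), Fin.ofNat 120 (u + 60)]
  else [Fin.ofNat 120 (triangleTable.getD (u - 60) 0)]

/-- The Cayley digraph of the alternating group on five letters, with generators of orders five and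
three whose quotient is an involution, in which the edges of the second kind are subdivided. Its
underlying graph is a subdivision of the graph of the rhombicosidodecahedron. -/
def subdividedCayley : Digraph (Fin 120) where
  Adj u v := v ∈ outs u

theorem step_subdividedCayley {u v : Fin 120} :
    Step subdividedCayley u v ↔ v ∈ u :: outs u := by
  simp [Step, subdividedCayley]

/-- The action on the vertices of a permutation of the group elements. -/
def onVertices (table : List ℕ) (u : Fin 120) : Fin 120 :=
  if u.val < 60 then Fin.ofNat 120 (table.getD u 0)
  else Fin.ofNat 120 (table.getD (u - 60) 0 + 60)

/-- Left multiplication by the inverse of the first generator. -/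
def pentagonInv : Fin 120 → Fin 120 := onVertices
  [14, 0, 13, 1, 2, 24, 25, 3, 4, 5, 6, 36, 37, 15, 7, 8, 9, 10, 11, 12, 23, 22, 48, 49, 26, 27,
   16, 17, 18, 19, 20, 21, 34, 35, 56, 57, 38, 39, 28, 29, 30, 31, 32, 33, 46, 47, 55, 54, 41,
   40, 42, 43, 44, 45, 59, 58, 50, 51, 52, 53]

/-- Left multiplication by the inverse of the second generator. -/
def triangleInv : Fin 120 → Fin 120 := onVertices
  [6, 13, 0, 24, 25, 1, 2, 36, 37, 15, 14, 3, 4, 5, 23, 22, 48, 49, 26, 27, 7, 8, 9, 10, 11, 12,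
   34, 35, 56, 57, 38, 39, 16, 17, 18, 19, 20, 21, 46, 47, 55, 54, 41, 40, 28, 29, 30, 31, 32,
   33, 59, 58, 50, 51, 42, 43, 44, 45, 53, 52]

/-- An endomorphism of finite order as an automorphism, whose inverse it is. -/
def automorphismOfIterate {V : Type*} {G : Digraph V} (f : V → V) (n : ℕ)
    (hf : ∀ u v, G.Adj u v → G.Adj (f u) (f v)) (hn : ∀ u, f^[n + 1] u = u) : G.Adj ≃r G.Adj where
  toFun := f^[n]
  invFun := f
  left_inv u := by rw [← Function.iterate_succ_apply' f n u, hn]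
  right_inv u := by rw [← Function.iterate_succ_apply f n u, hn]
  map_rel_iff' {u v} := by
    have key : ∀ m u v, G.Adj u v → G.Adj (f^[m] u) (f^[m] v) := by
      intro m
      induction m with
      | zero => exact fun u v h => h
      | succ m ih => exact fun u v h => ih _ _ (hf u v h)
    refine ⟨fun h => ?_, key n u v⟩
    have h' := hf _ _ h
    simp only [Equiv.coe_fn_mk, ← Function.iterate_succ_apply' f n, hn] at h'
    exact h'

/-- Left multiplication by the first generator. -/
def pentagonIso : subdividedCayley.Adj ≃r subdividedCayley.Adj :=
  automorphismOfIterate pentagonInv 4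
    (forall_mem_of_all (l := outs) (p := fun u v => pentagonInv v ∈ outs (pentagonInv u))
      (by decide +kernel))
    (by decide +kernel)

/-- Left multiplication by the second generator. -/
def triangleIso : subdividedCayley.Adj ≃r subdividedCayley.Adj :=
  automorphismOfIterate triangleInv 2
    (forall_mem_of_all (l := outs) (p := fun u v => triangleInv v ∈ outs (triangleInv u))
      (by decide +kernel))
    (by decide +kernel)

/-! ### The potential and the robber's strategy -/

/-- How much a cop at `u` hampers a robber who is at `0`. -/
def weight (u : Fin 120) : ℕ :=
  if u.val ∈ [0, 14, 66] then 12
  else if u.val ∈ [1, 10, 70] then 7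
  else if u.val ∈ [2, 4, 11, 20, 60, 64, 79] then 5
  else if u.val ∈ [3, 8, 9, 17, 18, 27, 29, 30, 61, 63, 68, 77, 89, 103] then 4
  else 0

/-- How much a cop at `u` hampers a robber who is about to go from `0` through `60` to `2`. -/
def triangleWeight (u : Fin 120) : ℕ :=
  if u = 0 ∨ u = 60 then 12
  else ((u :: outs u).map fun v => weight (triangleInv v)).foldr max 0

/-- With the cops at `c` and to move, a robber at `0` is safe. -/
def Safe (c : Fin 3 → Fin 120) : Prop :=
  ∑ i, weight (c i) < 12

/-- With the cops at `c` and to move, a robber at `60` is safe: it will get to `2`. -/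
def SafeMid (c : Fin 3 → Fin 120) : Prop :=
  (∀ i, c i ≠ 0 ∧ c i ≠ 60) ∧
    ∀ c' : Fin 3 → Fin 120, (∀ i, Step subdividedCayley (c i) (c' i)) →
      Safe fun i => triangleInv (c' i)

/-- Away from `0` and `60`, `triangleWeight` is the maximum, over the cop's next positions, of its
weight relative to a robber at `2`. It thus bounds every reply of the cops. -/
theorem safeMid_of_sum_lt {c : Fin 3 → Fin 120} (h : ∑ i, triangleWeight (c i) < 12) :
    SafeMid c := by
  have hle : ∀ i, triangleWeight (c i) < 12 := fun i =>
    (Finset.single_le_sum (f := fun i => triangleWeight (c i)) (fun _ _ => Nat.zero_le _)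
      (Finset.mem_univ i)).trans_lt h
  have hne : ∀ u, triangleWeight u < 12 → u ≠ 0 ∧ u ≠ 60 := by decide +kernel
  have key : ∀ u, ∀ v ∈ u :: outs u,
      triangleWeight u < 12 → weight (triangleInv v) ≤ triangleWeight u :=
    forall_mem_of_all (by decide +kernel)
  refine ⟨fun i => hne _ (hle i), fun c' hc' => ?_⟩
  exact (Finset.sum_le_sum fun i _ =>
    key _ _ (step_subdividedCayley.1 (hc' i)) (hle i)).trans_lt h

/-- A list of quadruples such that every move of a cop from `u` to `v` is at most as good for the
cops as one of them, with regard to the weight of `u` and those of `v` for the three options of the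
robber. -/
def copMoves : List (ℕ × ℕ × ℕ × ℕ) :=
  [(0, 0, 0, 7), (0, 4, 4, 0), (0, 5, 0, 4), (0, 12, 0, 0), (4, 4, 7, 0), (4, 5, 5, 0),
   (5, 7, 0, 12), (7, 7, 12, 0)]

/-- Dominated moves can be dropped, since safety only asks for small sums. This leaves eight types
of move per cop, hence 512 triples to test in `copMoves_insufficient`. -/
theorem exists_copMoves : ∀ u, ∀ v ∈ u :: outs u, weight u < 12 → ∃ d ∈ copMoves,
    d.1 ≤ weight u ∧ weight v ≤ d.2.1 ∧ weight (pentagonInv v) ≤ d.2.2.1 ∧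
      triangleWeight v ≤ d.2.2.2 := by
  have h : ∀ u, ∀ v ∈ u :: outs u, weight u < 12 → (copMoves.any fun d =>
      decide (d.1 ≤ weight u ∧ weight v ≤ d.2.1 ∧ weight (pentagonInv v) ≤ d.2.2.1 ∧
        triangleWeight v ≤ d.2.2.2)) = true :=
    forall_mem_of_all (by decide +kernel)
  simpa only [List.any_eq_true, decide_eq_true_eq] using h

theorem copMoves_insufficient : ∀ d ∈ copMoves, ∀ e ∈ copMoves, ∀ f ∈ copMoves,
    d.1 + e.1 + f.1 < 12 → d.2.1 + e.2.1 + f.2.1 < 12 ∨ d.2.2.1 + e.2.2.1 + f.2.2.1 < 12 ∨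
      d.2.2.2 + e.2.2.2 + f.2.2.2 < 12 := by
  decide +kernel

theorem Safe.weight_lt {c : Fin 3 → Fin 120} (h : Safe c) (i : Fin 3) : weight (c i) < 12 :=
  (Finset.single_le_sum (f := fun i => weight (c i)) (fun _ _ => Nat.zero_le _)
    (Finset.mem_univ i)).trans_lt h

theorem Safe.not_caught {c c' : Fin 3 → Fin 120} (h : Safe c)
    (hc : ∀ i, Step subdividedCayley (c i) (c' i)) (i : Fin 3) : c i ≠ 0 ∧ c' i ≠ 0 := by
  have key : ∀ u, ∀ v ∈ u :: outs u, weight u < 12 → u ≠ 0 ∧ v ≠ 0 :=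
    forall_mem_of_all (by decide +kernel)
  exact key _ _ (step_subdividedCayley.1 (hc i)) (h.weight_lt i)

theorem SafeMid.not_caught {c c' : Fin 3 → Fin 120} (h : SafeMid c)
    (hc : ∀ i, Step subdividedCayley (c i) (c' i)) (i : Fin 3) : c i ≠ 60 ∧ c' i ≠ 60 := by
  have key : ∀ u, ∀ v ∈ u :: outs u, u ≠ 0 ∧ u ≠ 60 → u ≠ 60 ∧ v ≠ 60 :=
    forall_mem_of_all (by decide +kernel)
  exact key _ _ (step_subdividedCayley.1 (hc i)) (h.1 i)

/-- After a move of the cops, a robber who was safe at `0` can stay there, or move to `1`, or set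
out for `2`. -/
theorem Safe.exists_option {c c' : Fin 3 → Fin 120} (h : Safe c)
    (hc : ∀ i, Step subdividedCayley (c i) (c' i)) :
    Safe c' ∨ (Safe fun i => pentagonInv (c' i)) ∨ SafeMid c' := by
  choose d hd hd₀ hd₁ hd₂ hd₃ using fun i =>
    exists_copMoves _ _ (step_subdividedCayley.1 (hc i)) (h.weight_lt i)
  have hsum : ∑ i, (d i).1 < 12 := (Finset.sum_le_sum fun i _ => hd₀ i).trans_lt h
  rw [Fin.sum_univ_three] at hsum
  have hle : ∀ {f g : Fin 3 → ℕ}, (∀ i, f i ≤ g i) → g 0 + g 1 + g 2 < 12 → ∑ i, f i < 12 := by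
    intro f g hfg hg
    rw [← Fin.sum_univ_three] at hg
    exact (Finset.sum_le_sum fun i _ => hfg i).trans_lt hg
  rcases copMoves_insufficient _ (hd 0) _ (hd 1) _ (hd 2) hsum with h' | h' | h'
  · exact Or.inl (hle hd₁ h')
  · exact Or.inr (Or.inl (hle hd₂ h'))
  · exact Or.inr (Or.inr (safeMid_of_sum_lt (hle hd₃ h')))

/-- Safety of a robber at any vertex: transported from `0` or `60` by an automorphism. -/
def SafeAt (r : Fin 120) (c : Fin 3 → Fin 120) : Prop :=
  ∃ φ : subdividedCayley.Adj ≃r subdividedCayley.Adj,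
    (r = φ 0 ∧ Safe fun i => φ.symm (c i)) ∨ (r = φ 60 ∧ SafeMid fun i => φ.symm (c i))

theorem step_map {V : Type*} {G : Digraph V} (φ : G.Adj ≃r G.Adj) {u v : V} (h : Step G u v) :
    Step G (φ u) (φ v) :=
  h.imp (congrArg φ) φ.map_rel_iff.2

/-- When the robber advances to `φ 1` or `φ 2`, the frame `φ` is precomposed with left
multiplication by the matching generator, which carries `0` to `1` or `2`. -/
theorem SafeAt.evade {r : Fin 120} {c c' : Fin 3 → Fin 120} (h : SafeAt r c)
    (hc : ∀ i, Step subdividedCayley (c i) (c' i)) :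
    (∀ i, c i ≠ r ∧ c' i ≠ r) ∧ ∃ r', Step subdividedCayley r r' ∧ SafeAt r' c' := by
  obtain ⟨φ, h⟩ := h
  have hφ : ∀ i, Step subdividedCayley (φ.symm (c i)) (φ.symm (c' i)) := fun i =>
    step_map φ.symm (hc i)
  have hne : ∀ {u v}, φ.symm u ≠ v → u ≠ φ v := fun h h' => h (h' ▸ φ.symm_apply_apply _)
  rcases h with ⟨rfl, h⟩ | ⟨rfl, h⟩
  · refine ⟨fun i => (h.not_caught hφ i).imp hne hne, ?_⟩
    rcases h.exists_option hφ with h' | h' | h'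
    · exact ⟨φ 0, Or.inl rfl, φ, Or.inl ⟨rfl, h'⟩⟩
    · refine ⟨φ 1, step_map φ (step_subdividedCayley.2 (by decide +kernel)),
        pentagonIso.trans φ, Or.inl ⟨?_, h'⟩⟩
      exact congrArg φ (show 1 = pentagonInv^[4] 0 by decide +kernel)
    · exact ⟨φ 60, step_map φ (step_subdividedCayley.2 (by decide +kernel)), φ, Or.inr ⟨rfl, h'⟩⟩
  · refine ⟨fun i => (h.not_caught hφ i).imp hne hne, φ 2,
      step_map φ (step_subdividedCayley.2 (by decide +kernel)),
      triangleIso.trans φ, Or.inl ⟨?_, h.2 _ hφ⟩⟩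
    exact congrArg φ (show 2 = triangleInv^[2] 0 by decide +kernel)

/-- Five places such that wherever three cops are, the robber is safe in one of them. -/
theorem exists_safeAt (c : Fin 3 → Fin 120) : ∃ r, SafeAt r c := by
  -- Each cop contributes at most 19 to the five totals together, so three cops contribute at most
  -- 57. Five unsafe places would need 5 · 12 = 60.
  have key : ∀ u, weight u + weight (triangleInv u) + weight (pentagonInv (pentagonInv u)) +
      weight (pentagonInv (triangleInv (pentagonInv u))) +
      weight (triangleInv (pentagonInv (triangleInv u))) < 20 := by
    decide +kernel
  by_contra! hno
  have h : ∀ φ : subdividedCayley.Adj ≃r subdividedCayley.Adj,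
      12 ≤ ∑ i, weight (φ.symm (c i)) := fun φ =>
    not_lt.1 fun h => hno (φ 0) ⟨φ, Or.inl ⟨rfl, h⟩⟩
  have h₁ : 12 ≤ ∑ i, weight (c i) := h (RelIso.refl _)
  have h₂ : 12 ≤ ∑ i, weight (triangleInv (c i)) := h triangleIso
  have h₃ : 12 ≤ ∑ i, weight (pentagonInv (pentagonInv (c i))) := h (pentagonIso.trans pentagonIso)
  have h₄ : 12 ≤ ∑ i, weight (pentagonInv (triangleInv (pentagonInv (c i)))) :=
    h ((pentagonIso.trans triangleIso).trans pentagonIso)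
  have h₅ : 12 ≤ ∑ i, weight (triangleInv (pentagonInv (triangleInv (c i)))) :=
    h ((triangleIso.trans pentagonIso).trans triangleIso)
  have k₀ := key (c 0)
  have k₁ := key (c 1)
  have k₂ := key (c 2)
  simp only [Fin.sum_univ_three] at h₁ h₂ h₃ h₄ h₅
  omega

theorem not_copsWin_subdividedCayley {k : ℕ} (hk : k ≤ 3) : ¬ CopsWin subdividedCayley k := by
  rcases Nat.eq_zero_or_pos k with rfl | hpos
  · rintro ⟨σ, hσ⟩
    obtain ⟨-, i, -⟩ := hσ (fun _ => 0) fun _ => Or.inl rfl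
    exact i.elim0
  · -- The missing cops are replaced by copies of the first one.
    let e : Fin 3 → Fin k := fun j => if h : j.val < k then ⟨j, h⟩ else ⟨0, hpos⟩
    have he : ∀ i : Fin k, e ⟨i, i.2.trans_le hk⟩ = i := fun i => by simp [e]
    refine not_copsWin_of_invariant (fun r c => SafeAt r (c ∘ e)) (fun c => exists_safeAt _) ?_
    intro r c c' h hc
    obtain ⟨hcaught, r', hr', h'⟩ := h.evade (c' := c' ∘ e) fun i => hc (e i)
    refine ⟨fun i => ?_, r', hr', h'⟩
    simpa only [Function.comp_apply, he] using hcaught ⟨i, i.2.trans_le hk⟩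

/-! ### Strong connectivity and the cop number -/

theorem stronglyConnected_subdividedCayley : StronglyConnected subdividedCayley := by
  let f : Fin 120 → Fin 120 := fun u => (outs u).headD 0
  let g : Fin 120 → Fin 120 := fun u => (outs u).getLastD 0
  have iter : ∀ h : Fin 120 → Fin 120, (∀ u, h u ∈ outs u) → ∀ n u,
      Relation.ReflTransGen subdividedCayley.Adj u (h^[n] u) := by
    intro h hh n
    induction n with
    | zero => exact fun u => .refl
    | succ n ih => exact fun u => (ih (h u)).head (hh u)
  have hf := iter f (by decide +kernel)
  have hg := iter g (by decide +kernel)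
  -- Iterating `f` on group elements runs round directed pentagons, and `g` runs round subdivided
  -- triangles, which are directed hexagons. One step of `f` is undone by four more, and one or two
  -- steps of `g` by five or four more. The numbering lets each nonzero vertex be reached from a
  -- smaller one.
  have key : ∀ u : Fin 120, u ≠ 0 → ∃ v < u, (f v = u ∨ g v = u ∨ g (g v) = u) ∧
      (f^[4] u = v ∨ g^[4] u = v ∨ g^[5] u = v) := by
    decide +kernel
  have both : ∀ n, ∀ u : Fin 120, u.val = n → Relation.ReflTransGen subdividedCayley.Adj 0 u ∧
      Relation.ReflTransGen subdividedCayley.Adj u 0 := by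
    intro n
    induction n using Nat.strong_induction_on with
    | _ n ih =>
      rintro u rfl
      by_cases hu : u = 0
      · exact hu ▸ ⟨.refl, .refl⟩
      obtain ⟨v, hv, hvu, huv⟩ := key u hu
      obtain ⟨h₀, h₁⟩ := ih v hv v rfl
      constructor
      · rcases hvu with h | h | h
        · exact h₀.trans (h ▸ hf 1 v)
        · exact h₀.trans (h ▸ hg 1 v)
        · exact h₀.trans (h ▸ hg 2 v)
      · rcases huv with h | h | h
        · exact (h ▸ hf 4 u : Relation.ReflTransGen _ u v).trans h₁
        · exact (h ▸ hg 4 u : Relation.ReflTransGen _ u v).trans h₁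
        · exact (h ▸ hg 5 u : Relation.ReflTransGen _ u v).trans h₁
  exact ⟨⟨0⟩, fun u v => (both _ u rfl).2.trans (both _ v rfl).1⟩

theorem four_le_copNumber_subdividedCayley : 4 ≤ copNumber subdividedCayley := by
  refine le_iInf₂ fun k hk => ?_
  have : 4 ≤ k := by
    by_contra! h
    exact not_copsWin_subdividedCayley (by omega) hk
  exact_mod_cast this

/-! ### Planarity by a straight-line drawing -/

/-- Twice the signed area of the triangle with vertices `a`, `b` and `z`. -/
noncomputable def cross (a b z : EuclideanSpace ℝ (Fin 2)) : ℝ :=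
  (b 0 - a 0) * (z 1 - a 1) - (b 1 - a 1) * (z 0 - a 0)

theorem cross_eq_zero_of_mem_segment {a b z : EuclideanSpace ℝ (Fin 2)}
    (hz : z ∈ segment ℝ a b) : cross a b z = 0 := by
  rw [segment_eq_image_lineMap] at hz
  obtain ⟨t, -, rfl⟩ := hz
  simp only [cross, AffineMap.lineMap_apply_module', PiLp.add_apply, PiLp.smul_apply,
    PiLp.sub_apply, smul_eq_mul]
  ring

theorem cross_pos_of_mem_segment {a b c d z : EuclideanSpace ℝ (Fin 2)} (hc : 0 < cross a b c)
    (hd : 0 < cross a b d) (hz : z ∈ segment ℝ c d) : 0 < cross a b z := by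
  obtain ⟨s, t, hs, ht, hst, rfl⟩ := hz
  have h : cross a b (s • c + t • d) = s * cross a b c + t * cross a b d := by
    obtain rfl : s = 1 - t := by linarith
    simp only [cross, PiLp.add_apply, PiLp.smul_apply, smul_eq_mul]
    ring
  rw [h]
  rcases hs.eq_or_lt with rfl | hs
  · obtain rfl : t = 1 := by linarith
    linarith
  · have := mul_pos hs hc
    have := mul_nonneg ht hd.le
    linarith

theorem eq_of_mem_segment_of_mem_segment {a b c z : EuclideanSpace ℝ (Fin 2)}
    (h : cross a b c ≠ 0) (hb : z ∈ segment ℝ a b) (hc : z ∈ segment ℝ a c) : z = a := by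
  have h₀ := cross_eq_zero_of_mem_segment hb
  rw [segment_eq_image_lineMap] at hc
  obtain ⟨t, -, rfl⟩ := hc
  have h₁ : cross a b (AffineMap.lineMap a c t) = t * cross a b c := by
    simp only [cross, AffineMap.lineMap_apply_module', PiLp.add_apply, PiLp.smul_apply,
      PiLp.sub_apply, smul_eq_mul]
    ring
  obtain rfl : t = 0 := by
    rw [h₁] at h₀
    exact (mul_eq_zero.1 h₀).resolve_right h
  simp

/-- A straight-line drawing of a graph without isolated vertices. -/
theorem nonempty_planeDrawing_of_segments {V : Type*} {H : SimpleGraph V}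
    {p : V → EuclideanSpace ℝ (Fin 2)} (hp : Function.Injective p)
    (hiso : ∀ u, ∃ v, H.Adj u v)
    (hmeet : ∀ u v u' v', H.Adj u v → H.Adj u' v' → s(u, v) ≠ s(u', v') →
      ∀ z ∈ segment ℝ (p u) (p v), z ∈ segment ℝ (p u') (p v') →
        ∃ w, w ∈ s(u, v) ∧ w ∈ s(u', v') ∧ z = p w) :
    Nonempty (PlaneDrawing H) := by
  let arc : Sym2 V → Set (EuclideanSpace ℝ (Fin 2)) :=
    Sym2.lift ⟨fun u v => segment ℝ (p u) (p v), fun u v => segment_symm ℝ _ _⟩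
  have arcs_meet : ∀ e ∈ H.edgeSet, ∀ f ∈ H.edgeSet, e ≠ f →
      ∀ x ∈ arc e, x ∈ arc f → ∃ w : V, w ∈ e ∧ w ∈ f ∧ x = p w := by
    intro e he f hf
    induction e with | _ u v
    induction f with | _ u' v'
    exact hmeet u v u' v' he hf
  refine ⟨⟨p, hp, arc, fun u v huv => ⟨Path.segment _ _,
    Path.segment_injective_of_ne (hp.ne huv.ne), Path.range_segment _ _⟩, fun e he w hw => ?_, arcs_meet⟩⟩
  -- A vertex on an arc is also on the arc of any edge at that vertex, so avoidance of foreign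
  -- vertices follows from `arcs_meet`.
  obtain ⟨v, hv⟩ := hiso w
  by_cases hev : e = s(w, v)
  · exact hev ▸ Sym2.mem_mk_left w v
  · obtain ⟨w', hw', -, h⟩ := arcs_meet e he s(w, v) hv hev _ hw (left_mem_segment ℝ _ _)
    exact hp h ▸ hw'

/-- The coordinates of the vertices in a straight-line drawing. -/
def coordTable : List (ℕ × ℕ) :=
  [(500, 331), (259, 511), (344, 314), (14, 338), (227, 358), (315, 292), (362, 257), (102, 51),
   (149, 260), (239, 323), (287, 357), (288, 299), (298, 269), (339, 189), (403, 47), (218, 156),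
   (186, 260), (169, 317), (224, 300), (256, 300), (274, 323), (268, 288), (290, 254),
   (325, 258), (309, 211), (290, 155), (229, 191), (170, 192), (204, 239), (214, 270),
   (198, 294), (228, 277), (262, 277), (283, 276), (277, 256), (284, 236), (307, 238),
   (281, 219), (255, 201), (229, 220), (201, 212), (226, 236), (237, 268), (244, 288),
   (250, 277), (261, 262), (274, 267), (264, 253), (265, 222), (280, 190), (238, 242),
   (221, 255), (234, 257), (251, 263), (255, 247), (272, 242), (263, 235), (245, 222),
   (248, 235), (247, 253), (423, 322), (242, 435), (353, 287), (81, 299), (258, 359), (306, 281),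
   (431, 293), (159, 103), (160, 288), (247, 311), (274, 434), (278, 295), (312, 264),
   (314, 171), (372, 118), (194, 173), (201, 264), (91, 328), (227, 290), (266, 312), (257, 322),
   (276, 283), (288, 245), (321, 276), (295, 216), (345, 101), (230, 207), (137, 120),
   (215, 239), (205, 283), (192, 278), (236, 283), (261, 270), (287, 289), (272, 255),
   (294, 237), (300, 245), (281, 206), (260, 213), (214, 216), (216, 203), (223, 247),
   (244, 265), (233, 293), (245, 271), (267, 265), (269, 272), (269, 248), (255, 221),
   (294, 201), (243, 247), (212, 248), (235, 249), (251, 269), (252, 242), (275, 248),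
   (259, 240), (251, 212), (254, 234), (241, 256)]

/-- The coordinates of a vertex. -/
def coord (u : Fin 120) : ℕ × ℕ :=
  coordTable.getD u (0, 0)

/-- The position of a vertex in the plane. -/
noncomputable def position (u : Fin 120) : EuclideanSpace ℝ (Fin 2) :=
  !₂[((coord u).1 : ℝ), ((coord u).2 : ℝ)]

/-- Whether `c` is on the left of the line from `a` to `b`. -/
def isLeft (a b c : ℕ × ℕ) : Bool :=
  Nat.blt (a.1 * c.2 + c.1 * b.2 + b.1 * a.2) (a.1 * b.2 + b.1 * c.2 + c.1 * a.2)

/-- Whether `a`, `b` and `c` are not on a line. -/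
def notCollinear (a b c : ℕ × ℕ) : Bool :=
  isLeft a b c || isLeft a c b

/-- Whether the points `c` and `d` are strictly on one side of the line from `a` to `b`. -/
def sameSide (a b c d : ℕ × ℕ) : Bool :=
  (isLeft a b c && isLeft a b d) || (isLeft b a c && isLeft b a d)

/-- A sufficient condition for two straight edges to meet in common ends only. Each of them is given
by its ends and their coordinates. -/
def meetProperly (e f : (ℕ × ℕ × ℕ) × (ℕ × ℕ × ℕ)) : Bool :=
  if Nat.beq e.1.1 f.1.1 then notCollinear e.1.2 e.2.2 f.2.2
  else if Nat.beq e.1.1 f.2.1 then notCollinear e.1.2 e.2.2 f.1.2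
  else if Nat.beq e.2.1 f.1.1 then notCollinear e.2.2 e.1.2 f.2.2
  else if Nat.beq e.2.1 f.2.1 then notCollinear e.2.2 e.1.2 f.1.2
  else sameSide e.1.2 e.2.2 f.1.2 f.2.2 || sameSide f.1.2 f.2.2 e.1.2 e.2.2

/-- Whether every element of a list is in relation `r` to all later ones. -/
def allPairs {α : Type*} (r : α → α → Bool) : List α → Bool
  | [] => true
  | a :: l => l.all (r a) && allPairs r l

theorem pairwise_of_allPairs {α : Type*} {r : α → α → Bool} :
    ∀ {l : List α}, allPairs r l = true → l.Pairwise fun a b => r a b = true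
  | [], _ => .nil
  | a :: l, h => by
    rw [allPairs, Bool.and_eq_true, List.all_eq_true] at h
    exact .cons h.1 (pairwise_of_allPairs h.2)

theorem coord_injective : Function.Injective coord := by
  have h : allPairs (fun a b => !(Nat.beq a.1 b.1 && Nat.beq a.2 b.2)) coordTable = true := by
    decide +kernel
  have hnodup : coordTable.Nodup := by
    refine (pairwise_of_allPairs h).imp fun {a b} hab hne => ?_
    subst hne
    simp at hab
  intro u v huv
  have hu : u.val < coordTable.length := u.2
  have hv : v.val < coordTable.length := v.2
  rw [coord, coord, List.getD_eq_getElem _ _ hu, List.getD_eq_getElem _ _ hv] at huv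
  exact Fin.ext (hnodup.getElem_inj_iff.1 huv)

theorem position_injective : Function.Injective position := by
  intro u v huv
  refine coord_injective (Prod.ext ?_ ?_)
  · simpa [position] using congrArg (fun z => z 0) huv
  · simpa [position] using congrArg (fun z => z 1) huv

/-- `isLeft` compares the positive with the negative terms of the expanded determinant, so no
subtraction of natural numbers occurs. -/
theorem cross_pos_of_isLeft {a b c : Fin 120} (h : isLeft (coord a) (coord b) (coord c) = true) :
    0 < cross (position a) (position b) (position c) := by
  rw [isLeft, Nat.blt_eq] at h
  have h' : (((coord a).1 * (coord c).2 + (coord c).1 * (coord b).2 + (coord b).1 * (coord a).2 : ℕ)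
      : ℝ) < (((coord a).1 * (coord b).2 + (coord b).1 * (coord c).2 +
        (coord c).1 * (coord a).2 : ℕ) : ℝ) := by
    exact_mod_cast h
  push_cast at h'
  simp only [cross, position, PiLp.toLp_apply, Matrix.cons_val_zero, Matrix.cons_val_one]
  linarith

theorem cross_swap (a b c : EuclideanSpace ℝ (Fin 2)) : cross a c b = -cross a b c := by
  simp only [cross]
  ring

theorem cross_ne_zero_of_notCollinear {a b c : Fin 120}
    (h : notCollinear (coord a) (coord b) (coord c) = true) :
    cross (position a) (position b) (position c) ≠ 0 := by
  rw [notCollinear, Bool.or_eq_true] at h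
  rcases h with h | h
  · exact (cross_pos_of_isLeft h).ne'
  · have := cross_pos_of_isLeft h
    rw [cross_swap] at this
    exact (neg_pos.1 this).ne

theorem disjoint_of_sameSide {a b c d : Fin 120}
    (h : sameSide (coord a) (coord b) (coord c) (coord d) = true)
    {z : EuclideanSpace ℝ (Fin 2)} (hz : z ∈ segment ℝ (position a) (position b))
    (hz' : z ∈ segment ℝ (position c) (position d)) : False := by
  rw [sameSide, Bool.or_eq_true, Bool.and_eq_true, Bool.and_eq_true] at h
  rcases h with h | h
  · exact (cross_pos_of_mem_segment (cross_pos_of_isLeft h.1) (cross_pos_of_isLeft h.2) hz').ne'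
      (cross_eq_zero_of_mem_segment hz)
  · exact (cross_pos_of_mem_segment (cross_pos_of_isLeft h.1) (cross_pos_of_isLeft h.2) hz').ne'
      (cross_eq_zero_of_mem_segment (segment_symm ℝ (position a) (position b) ▸ hz))

/-- An edge together with the coordinates of its ends. -/
def drawnEdge (e : Fin 120 × Fin 120) : (ℕ × ℕ × ℕ) × (ℕ × ℕ × ℕ) :=
  ((e.1.val, coord e.1), (e.2.val, coord e.2))

/-- Two straight edges meet in common ends only. -/
def MeetInEnds (e f : Fin 120 × Fin 120) : Prop :=
  ∀ z ∈ segment ℝ (position e.1) (position e.2), z ∈ segment ℝ (position f.1) (position f.2) →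
    ∃ w, w ∈ s(e.1, e.2) ∧ w ∈ s(f.1, f.2) ∧ z = position w

/-- Needed because `allPairs` tests each pair of edges in one order only. -/
instance : Std.Symm MeetInEnds where
  symm _ _ h z hf he := (h z he hf).imp fun _ hw => ⟨hw.2.1, hw.1, hw.2.2⟩

theorem meetInEnds_of_meetProperly {e f : Fin 120 × Fin 120}
    (h : meetProperly (drawnEdge e) (drawnEdge f) = true) : MeetInEnds e f := by
  obtain ⟨a, b⟩ := e
  obtain ⟨c, d⟩ := f
  intro z he hf
  simp only [meetProperly, drawnEdge, Nat.beq_eq, Fin.val_inj] at h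
  dsimp only at he hf
  split_ifs at h with h₁ h₂ h₃ h₄
  · subst h₁
    exact ⟨a, by simp, by simp,
      eq_of_mem_segment_of_mem_segment (cross_ne_zero_of_notCollinear h) he hf⟩
  · subst h₂
    rw [segment_symm] at hf
    exact ⟨a, by simp, by simp,
      eq_of_mem_segment_of_mem_segment (cross_ne_zero_of_notCollinear h) he hf⟩
  · subst h₃
    rw [segment_symm] at he
    exact ⟨b, by simp, by simp,
      eq_of_mem_segment_of_mem_segment (cross_ne_zero_of_notCollinear h) he hf⟩
  · subst h₄
    rw [segment_symm] at he hf
    exact ⟨b, by simp, by simp,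
      eq_of_mem_segment_of_mem_segment (cross_ne_zero_of_notCollinear h) he hf⟩
  · rw [Bool.or_eq_true] at h
    exact (h.elim (fun h => disjoint_of_sameSide h he hf)
      fun h => disjoint_of_sameSide h hf he).elim

/-- The edges of the digraph. -/
def edges : List (Fin 120 × Fin 120) :=
  (List.finRange 120).flatMap fun u => (outs u).map fun v => (u, v)

theorem mem_edges {u v : Fin 120} : (u, v) ∈ edges ↔ v ∈ outs u := by
  simp [edges]

theorem pairwise_meetInEnds : edges.Pairwise MeetInEnds := by
  have h : allPairs meetProperly (edges.map drawnEdge) = true := by decide +kernel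
  exact (List.pairwise_map.1 (pairwise_of_allPairs h)).imp meetInEnds_of_meetProperly

theorem planar_subdividedCayley : Planar subdividedCayley := by
  refine nonempty_planeDrawing_of_segments position_injective (fun u => ?_) ?_
  · have h : ∀ u : Fin 120, ((outs u).any fun v => decide (u ≠ v)) = true := by decide +kernel
    obtain ⟨v, hv, huv⟩ := List.any_eq_true.1 (h u)
    exact ⟨v, of_decide_eq_true huv, Or.inl hv⟩
  · have meet : ∀ {e f}, e ∈ edges → f ∈ edges → e ≠ f → MeetInEnds e f := fun he hf hef =>
      pairwise_meetInEnds.forall he hf hef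
    have edge : ∀ {u v : Fin 120}, subdividedCayley.toSimpleGraphInclusive.Adj u v →
        ∃ e ∈ edges, s(e.1, e.2) = s(u, v) ∧
          segment ℝ (position e.1) (position e.2) = segment ℝ (position u) (position v) := by
      rintro u v ⟨-, h | h⟩
      · exact ⟨(u, v), mem_edges.2 h, rfl, rfl⟩
      · exact ⟨(v, u), mem_edges.2 h, Sym2.eq_swap, segment_symm ℝ _ _⟩
    intro u v u' v' h h' hne
    obtain ⟨e, he, hs, hseg⟩ := edge h
    obtain ⟨f, hf, hs', hseg'⟩ := edge h'
    rw [← hs, ← hs', ← hseg, ← hseg']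
    exact meet he hf fun hef => hne (by rw [← hs, ← hs', hef])

end CopsRobbers

theorem theorem1p3 :
    ∃ (V : Type) (_ : Finite V) (G : Digraph V),
      CopsRobbers.StronglyConnected G ∧ CopsRobbers.Planar G ∧
        ¬ CopsRobbers.CopsWin G 3 ∧ 4 ≤ CopsRobbers.copNumber G := by
  exact ⟨Fin 120, inferInstance, CopsRobbers.subdividedCayley,
    CopsRobbers.stronglyConnected_subdividedCayley, CopsRobbers.planar_subdividedCayley,
    CopsRobbers.not_copsWin_subdividedCayley le_rfl,
    CopsRobbers.four_le_copNumber_subdividedCayley⟩
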